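/- Let $\alpha\in(1,2]$, $\beta=\alpha/(\alpha-1)$, $\varphi(x)=|x|^\alpha/\alpha$, $\gamma\in(0,1]$ with $\gamma\beta>1$, $H_1,H_2\in(0,1]$ and $A\ge 0$. On a probability space, a random variable $\zeta$ is called $\varphi$-sub-Gaussian if $\mathsf E\zeta=0$, $\mathsf E e^{\lambda\zeta}<\infty$ for all $\lambda\in\mathbb R$, and for some $a>0$ one has $\mathsf E e^{\lambda\zeta}\le e^{\varphi(a\lambda)}$ for all $\lambda\in\mathbb R$; $\tau_\varphi(\zeta)$ denotes the infimum of all such $a>0$. Let $V=[0,\infty)\times[-A,A]$ carry the metric $d(t,s)=|t_1-s_1|^{H_1}+|t_2-s_2|^{H_2}$. Let $f:[0,\infty)\to(0,\infty)$ be continuous and strictly increasing with $f(t)\to\infty$ as $t\to\infty$, and let $0=b_0<b_1<b_2<\cdots$ with $b_k\to\infty$. Put $V_k=[b_k,b_{k+1}]\times[-A,A]$, $l_k=b_{k+1}-b_k$, $f_k=f(b_k)$. Let $X(t)$, $t\in V$, be a random field, separable on $(V,d)$ in the sense of Doob, whose values $X(t)$ are $\varphi$-sub-Gaussian random variables. Put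 $\varepsilon_k=\sup_{t\in V_k}\tau_\varphi(X(t))$ and suppose that $0<\varepsilon_k<\infty$ for every $k\ge 0$. Suppose further that (i) there are constants $c_k>0$ such that for every $k\ge 0$ and $h>0$ $$\sup_{t,s\in V_k,\ d(t,s)\le h}\tau_\varphi(X(t)-X(s))\le c_kh^\gamma;$$ (ii) $C=\sum_{k=0}^\infty \dfrac{\varepsilon_k}{f_k}<\infty$; (iii) $S=\sum_{k=0}^\infty \dfrac{\varepsilon_k^{1-\frac1{\gamma\beta}}c_1(k)}{f_k}<\infty$, where $$c_1(k)=\Big(\tfrac1{H_1}(l_k/2)^{H_1/\beta}+\tfrac1{H_2}A^{H_2/\beta}\Big)\frac{2^{1/\beta}c_k^{1/(\gamma\beta)}}{1-\frac1{\gamma\beta}}.$$ Let $\gamma_k=c_k\max_{t,s\in V_k}d(t,s)^\gamma$ and $\tilde\theta=\inf_k\gamma_k/\varepsilon_k$. Then $\sup_{t\in V}|X(t)|/f(t_1)$ is measurable up to a null set, and for every $\theta\in(0,\min(1,\tilde\theta))$: (a) for all $\lambda>0$, $$\mathsf E\exp\Big\{\lambda\sup_{(t_1,t_2)\in V}\frac{|X(t_1,t_2)|}{f(t_1)}\Big\}\le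 2\exp\Big\{\frac{\lambda^\alpha}{\alpha}\Big(\frac C{1-\theta}\Big)^\alpha+\frac{2\lambda}{(1-\theta)\theta^{1/(\gamma\beta)}}S\Big\};$$ (b) for all $u>\dfrac{2S}{(1-\theta)\theta^{1/(\gamma\beta)}}$, $$\mathsf P\Big\{\sup_{(t_1,t_2)\in V}\frac{|X(t_1,t_2)|}{f(t_1)}>u\Big\}\le 2\exp\Big\{-\frac1{\beta C^\beta}\Big(u(1-\theta)-2S\theta^{-1/(\gamma\beta)}\Big)^\beta\Big\}.$$ -/

import Mathlib

open MeasureTheory ProbabilityTheory Filter Set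
open scoped ENNReal

noncomputable section

namespace PhiSub

/-- The function `φ(x) = |x|^α / α`. -/
def phi (α x : ℝ) : ℝ := |x| ^ α / α

variable {Ω : Type*} [MeasurableSpace Ω]

/-- The random variable `ζ` belongs to `Sub_φ(Ω)`: it is centered, all its exponential moments
exist, and `E exp(lam ζ) ≤ exp(φ(lam a))` for all real `lam`, for some `a > 0`. -/
structure IsPhiSubGaussian (φ : ℝ → ℝ) (P : Measure Ω) (ζ : Ω → ℝ) : Prop where
  aemeasurable : AEMeasurable ζ P
  integrable : Integrable ζ P
  mean_zero : ∫ ω, ζ ω ∂P = 0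
  integrable_exp : ∀ lam : ℝ, Integrable (fun ω => Real.exp (lam * ζ ω)) P
  bound : ∃ a : ℝ, 0 < a ∧ ∀ lam : ℝ, ∫ ω, Real.exp (lam * ζ ω) ∂P ≤ Real.exp (φ (lam * a))

/-- The norm `τ_φ(ζ)`, the infimum of all `a > 0` with `E exp(lam ζ) ≤ exp(φ(a lam))` for all
real `lam`. -/
def tau (φ : ℝ → ℝ) (P : Measure Ω) (ζ : Ω → ℝ) : ℝ :=
  sInf {a : ℝ | 0 < a ∧ ∀ lam : ℝ,
    Integrable (fun ω => Real.exp (lam * ζ ω)) P ∧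
      ∫ ω, Real.exp (lam * ζ ω) ∂P ≤ Real.exp (φ (a * lam))}

/-- Separability of the field `X(t)`, `t ∈ T` (in the sense of Doob): there are a countable dense
set `D ⊆ T` and one null set `N` such that, for every relatively open part `G ∩ T` of `T` and
every closed `F ⊆ ℝ`, the events `{X(t) ∈ F for all t ∈ G ∩ D}` and
`{X(t) ∈ F for all t ∈ G ∩ T}` coincide outside `N` (the second is always contained in the
first). -/
def IsSeparableField {E : Type*} [TopologicalSpace E] (P : Measure Ω) (T : Set E)
    (X : E → Ω → ℝ) : Prop :=
  ∃ D : Set E, D ⊆ T ∧ D.Countable ∧ T ⊆ closure D ∧ ∃ N : Set Ω, P N = 0 ∧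
    ∀ (G : Set E) (F : Set ℝ), IsOpen G → IsClosed F →
      {ω | ∀ t ∈ G ∩ D, X t ω ∈ F} \ {ω | ∀ t ∈ G ∩ T, X t ω ∈ F} ⊆ N

/-- The anisotropic metric `d(t, s) = |t₁ - s₁|^H₁ + |t₂ - s₂|^H₂` on the plane. For
`H₁, H₂ ∈ (0, 1]` it induces the usual topology. -/
def dist2 (H₁ H₂ : ℝ) (t s : ℝ × ℝ) : ℝ := |t.1 - s.1| ^ H₁ + |t.2 - s.2| ^ H₂

/-- The unbounded domain `V = [0, ∞) × [-A, A]`. -/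
def domainV (A : ℝ) : Set (ℝ × ℝ) := Ici 0 ×ˢ Icc (-A) A

/-- The block `V_k = [b_k, b_{k+1}] × [-A, A]`. -/
def block (A : ℝ) (b : ℕ → ℝ) (k : ℕ) : Set (ℝ × ℝ) := Icc (b k) (b (k + 1)) ×ˢ Icc (-A) A

/-- `ε_k`, the supremum of `τ_φ(X(t))` over `t ∈ V_k`. -/
def eps (φ : ℝ → ℝ) (P : Measure Ω) (X : ℝ × ℝ → Ω → ℝ) (A : ℝ) (b : ℕ → ℝ) (k : ℕ) : ℝ :=
  sSup ((fun t => tau φ P (X t)) '' block A b k)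

/-- `γ_k`, which is `c_k` times the maximum of `d(t, s)^γ` over `t, s ∈ V_k`. -/
def gam (γ H₁ H₂ A : ℝ) (b c : ℕ → ℝ) (k : ℕ) : ℝ :=
  c k * sSup ((fun p : (ℝ × ℝ) × (ℝ × ℝ) => dist2 H₁ H₂ p.1 p.2 ^ γ) ''
    (block A b k ×ˢ block A b k))

/-- `c₁(k)`, where `β` is the exponent conjugate to `α`. -/
def cOne (β γ H₁ H₂ A : ℝ) (b c : ℕ → ℝ) (k : ℕ) : ℝ :=
  (1 / H₁ * ((b (k + 1) - b k) / 2) ^ (H₁ / β) + 1 / H₂ * A ^ (H₂ / β)) *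
    (2 ^ (1 / β) * c k ^ (1 / (γ * β)) / (1 - 1 / (γ * β)))

/-- The weighted supremum of `|X(t)| / f(t₁)` over `t ∈ V`, an extended real number. -/
def supRatio (X : ℝ × ℝ → Ω → ℝ) (f : ℝ → ℝ) (A : ℝ) (ω : Ω) : EReal :=
  ⨆ t : domainV A, ((|X t.1 ω| / f t.1.1 : ℝ) : EReal)

end PhiSub

end

/-! The field is chained on each block, and the blocks are glued together by Hölder's inequality. A
bound `E exp(λZ) ≤ 2 exp((λa)^α/α + λm)` is recorded as a pair (a, m) of scale and drift. By
`ExpTailBound.add` such pairs add up without any independence: the Hölder weights are proportional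
to the scales and sum to 1, so the factor 2 does not multiply. Any number of chain links and of
blocks therefore costs a single factor 2.

The basic estimate is `expTailBound_maxAbs`: a maximum of at most e^L variables of scale a has the
pair (a, 2aL^(1/β)). On block k, nets of accuracy θ^(n+1)ε_k give links whose scales sum to at most
ε_k/(1-θ); their drifts form a geometric series that plays the role of the entropy integral
(`expTailBound_maxAbs_of_nets`, `entropy_rpow_le`, `sum_geometric_rpow_le`). Dividing by f(b_k) and
summing over k yields the scale C/(1-θ) and the drift 2S/((1-θ)θ^(1/(γβ))).

All this is done for finite index sets, with bounds independent of the set. Separability reduces the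
supremum to a countable set, where monotone convergence applies and gives (a). Part (b) is the
Chernoff bound with the optimal λ. -/

namespace PhiSub

/-! ### Finite maxima. -/

section MaxAbs

variable {Ω ι : Type*}

/-- The pointwise maximum of `|Y i|` over a finite set of indices. -/
def maxAbs (F : Finset ι) (Y : ι → Ω → ℝ) (ω : Ω) : ℝ :=
  ((F.sup fun i => ‖Y i ω‖₊ : NNReal) : ℝ)

theorem maxAbs_nonneg (F : Finset ι) (Y : ι → Ω → ℝ) (ω : Ω) : 0 ≤ maxAbs F Y ω :=
  NNReal.coe_nonneg _

theorem abs_le_maxAbs {F : Finset ι} (Y : ι → Ω → ℝ) (ω : Ω) {i : ι} (hi : i ∈ F) :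
    |Y i ω| ≤ maxAbs F Y ω := by
  have : ‖Y i ω‖₊ ≤ F.sup fun i => ‖Y i ω‖₊ := Finset.le_sup (f := fun i => ‖Y i ω‖₊) hi
  exact_mod_cast this

theorem exists_maxAbs_eq {F : Finset ι} (hF : F.Nonempty) (Y : ι → Ω → ℝ) (ω : Ω) :
    ∃ i ∈ F, maxAbs F Y ω = |Y i ω| := by
  obtain ⟨i, hi, h⟩ := Finset.exists_mem_eq_sup F hF fun i => ‖Y i ω‖₊
  exact ⟨i, hi, by simp [maxAbs, h]⟩

end MaxAbs

/-! ### Calculus of exponential moment bounds and the maximal inequality. -/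

section ExpMoments

variable {Ω : Type*} [MeasurableSpace Ω] {P : Measure Ω}

/-- Hölder's inequality for exponential moments. -/
theorem lintegral_exp_add_le {U V : Ω → ℝ} (hU : AEMeasurable U P) (hV : AEMeasurable V P)
    {p q x y : ℝ} (hp : 0 < p) (hq : 0 < q) (hpq : p + q = 1)
    (hx : ∫⁻ ω, ENNReal.ofReal (Real.exp (U ω / p)) ∂P ≤ ENNReal.ofReal (Real.exp x))
    (hy : ∫⁻ ω, ENNReal.ofReal (Real.exp (V ω / q)) ∂P ≤ ENNReal.ofReal (Real.exp y)) :
    ∫⁻ ω, ENNReal.ofReal (Real.exp (U ω + V ω)) ∂P ≤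
      ENNReal.ofReal (Real.exp (p * x + q * y)) := by
  have hmU : AEMeasurable (fun ω => ENNReal.ofReal (Real.exp (U ω / p))) P :=
    (Real.measurable_exp.comp_aemeasurable (hU.div_const p)).ennreal_ofReal
  have hmV : AEMeasurable (fun ω => ENNReal.ofReal (Real.exp (V ω / q))) P :=
    (Real.measurable_exp.comp_aemeasurable (hV.div_const q)).ennreal_ofReal
  have key := ENNReal.lintegral_mul_norm_pow_le hmU hmV hp.le hq.le hpq
  have e1 : ∀ (z r : ℝ), 0 < r →
      ENNReal.ofReal (Real.exp z) ^ r = ENNReal.ofReal (Real.exp (r * z)) := by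
    intro z r hr
    rw [ENNReal.ofReal_rpow_of_pos (Real.exp_pos _), ← Real.exp_mul, mul_comm]
  calc ∫⁻ ω, ENNReal.ofReal (Real.exp (U ω + V ω)) ∂P
      = ∫⁻ ω, ENNReal.ofReal (Real.exp (U ω / p)) ^ p *
          ENNReal.ofReal (Real.exp (V ω / q)) ^ q ∂P := by
        refine lintegral_congr fun ω => ?_
        rw [e1 _ _ hp, e1 _ _ hq, ← ENNReal.ofReal_mul (Real.exp_pos _).le, ← Real.exp_add,
          mul_div_cancel₀ _ hp.ne', mul_div_cancel₀ _ hq.ne']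
    _ ≤ _ := key
    _ ≤ ENNReal.ofReal (Real.exp x) ^ p * ENNReal.ofReal (Real.exp y) ^ q := by gcongr
    _ = _ := by
        rw [e1 _ _ hp, e1 _ _ hq, ← ENNReal.ofReal_mul (Real.exp_pos _).le, ← Real.exp_add]

/-- Lyapunov's inequality for exponential moments. -/
theorem lintegral_exp_mul_le [IsProbabilityMeasure P] {U : Ω → ℝ} (hU : AEMeasurable U P)
    {p x : ℝ} (hp : 0 < p) (hp1 : p ≤ 1)
    (hx : ∫⁻ ω, ENNReal.ofReal (Real.exp (U ω)) ∂P ≤ ENNReal.ofReal (Real.exp x)) :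
    ∫⁻ ω, ENNReal.ofReal (Real.exp (p * U ω)) ∂P ≤ ENNReal.ofReal (Real.exp (p * x)) := by
  rcases hp1.eq_or_lt with rfl | hp1
  · simpa using hx
  have := lintegral_exp_add_le (P := P) (U := fun ω => p * U ω) (V := fun _ => 0) (p := p)
    (q := 1 - p) (x := x) (y := 0) (hU.const_mul p) aemeasurable_const hp (by linarith) (by ring)
    (by simpa [mul_div_cancel_left₀ _ hp.ne'] using hx) (by simp)
  simpa using this

/-- `ζ` satisfies the `φ`-sub-Gaussian moment bound with constant `a`, for `φ(x) = |x|^α / α`. -/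
def SubExpBound (α : ℝ) (P : Measure Ω) (ζ : Ω → ℝ) (a : ℝ) : Prop :=
  AEMeasurable ζ P ∧ ∀ lam : ℝ,
    ∫⁻ ω, ENNReal.ofReal (Real.exp (lam * ζ ω)) ∂P ≤ ENNReal.ofReal (Real.exp (phi α (lam * a)))

/-- The bound `E exp(lam Z) ≤ 2 exp((lam a)^α / α + lam m)` for all `lam > 0`. -/
def ExpTailBound (α : ℝ) (P : Measure Ω) (Z : Ω → ℝ) (a m : ℝ) : Prop :=
  AEMeasurable Z P ∧ ∀ lam : ℝ, 0 < lam →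
    ∫⁻ ω, ENNReal.ofReal (Real.exp (lam * Z ω)) ∂P ≤
      ENNReal.ofReal (Real.exp (Real.log 2 + (lam * a) ^ α / α + lam * m))

theorem phi_mono {α x y : ℝ} (hα : 0 < α) (h : |x| ≤ |y|) : phi α x ≤ phi α y := by
  unfold phi
  gcongr

theorem SubExpBound.mono {α a b : ℝ} {ζ : Ω → ℝ} (hα : 0 < α) (h : SubExpBound α P ζ a)
    (ha : 0 ≤ a) (hab : a ≤ b) : SubExpBound α P ζ b := by
  refine ⟨h.1, fun lam => (h.2 lam).trans (ENNReal.ofReal_le_ofReal (Real.exp_le_exp.2 ?_))⟩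
  refine phi_mono hα ?_
  rw [abs_mul, abs_mul, abs_of_nonneg ha, abs_of_nonneg (ha.trans hab)]
  gcongr

theorem SubExpBound.neg {α a : ℝ} {ζ : Ω → ℝ} (h : SubExpBound α P ζ a) :
    SubExpBound α P (fun ω => -ζ ω) a := by
  refine ⟨h.1.neg, fun lam => ?_⟩
  simpa [phi, abs_mul] using h.2 (-lam)

/-- With Hölder exponents (a+b)/a and (a+b)/b both factors are evaluated at the same point `lam * (a
+ b)` of φ, so the weighted mean of the two bounds is again that value. -/
theorem SubExpBound.add {α a b : ℝ} {ζ ξ : Ω → ℝ} (ha : 0 < a) (hb : 0 < b)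
    (h : SubExpBound α P ζ a) (h' : SubExpBound α P ξ b) :
    SubExpBound α P (fun ω => ζ ω + ξ ω) (a + b) := by
  refine ⟨h.1.add h'.1, fun lam => ?_⟩
  have hab : 0 < a + b := by positivity
  have := lintegral_exp_add_le (P := P) (U := fun ω => lam * ζ ω) (V := fun ω => lam * ξ ω)
    (p := a / (a + b)) (q := b / (a + b)) (x := phi α (lam * (a + b))) (y := phi α (lam * (a + b)))
    (h.1.const_mul _) (h'.1.const_mul _) (by positivity) (by positivity) (by field_simp)
    (by
      have e1 : ∀ ω, lam * ζ ω / (a / (a + b)) = lam * (a + b) / a * ζ ω := fun ω => by field_simp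
      have e2 : lam * (a + b) = lam * (a + b) / a * a := by field_simp
      simp only [e1]
      nth_rw 2 [e2]
      exact h.2 _)
    (by
      have e1 : ∀ ω, lam * ξ ω / (b / (a + b)) = lam * (a + b) / b * ξ ω := fun ω => by field_simp
      have e2 : lam * (a + b) = lam * (a + b) / b * b := by field_simp
      simp only [e1]
      nth_rw 2 [e2]
      exact h'.2 _)
  have e : a / (a + b) * phi α (lam * (a + b)) + b / (a + b) * phi α (lam * (a + b)) =
      phi α (lam * (a + b)) := by field_simp
  simpa only [mul_add lam (ζ _), e] using this

/-- The moment bound is a closed condition on the constant, because φ is continuous. This is what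
lets the infimum in `tau` be used as a constant. -/
theorem SubExpBound.of_forall_gt {α a : ℝ} {ζ : Ω → ℝ} (hα : 0 < α)
    (h : ∀ b, a < b → SubExpBound α P ζ b) : SubExpBound α P ζ a := by
  refine ⟨(h (a + 1) (by linarith)).1, fun lam => ?_⟩
  have hcont : Continuous fun b : ℝ => ENNReal.ofReal (Real.exp (phi α (lam * b))) := by
    have : Continuous fun b : ℝ => |lam * b| ^ α :=
      (continuous_const.mul continuous_id).abs.rpow_const fun _ => Or.inr hα.le
    exact ENNReal.continuous_ofReal.comp (Real.continuous_exp.comp (this.div_const α))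
  refine ge_of_tendsto (hcont.continuousWithinAt (s := Ioi a) (x := a)).tendsto ?_
  filter_upwards [self_mem_nhdsWithin] with b hb
  exact (h b hb).2 lam

theorem ExpTailBound.mono {α a b m n : ℝ} {Z W : Ω → ℝ} (hα : 0 < α) (h : ExpTailBound α P W a m)
    (hZ : AEMeasurable Z P) (hZW : ∀ ω, Z ω ≤ W ω) (ha : 0 ≤ a) (hab : a ≤ b) (hmn : m ≤ n) :
    ExpTailBound α P Z b n := by
  refine ⟨hZ, fun lam hlam => ?_⟩
  calc _ ≤ ∫⁻ ω, ENNReal.ofReal (Real.exp (lam * W ω)) ∂P := by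
        refine lintegral_mono fun ω => ?_
        gcongr
        exact hZW ω
    _ ≤ _ := h.2 lam hlam
    _ ≤ _ := by gcongr

/-- Same Hölder weights as for `SubExpBound.add`. The terms `log 2` are averaged and not added,
while the drifts are multiplied by (a+b)/a or (a+b)/b and then by the inverse weight, hence add. -/
theorem ExpTailBound.add {α a b m n : ℝ} {Z W : Ω → ℝ} (ha : 0 < a) (hb : 0 < b)
    (h : ExpTailBound α P Z a m) (h' : ExpTailBound α P W b n) :
    ExpTailBound α P (fun ω => Z ω + W ω) (a + b) (m + n) := by
  refine ⟨h.1.add h'.1, fun lam hlam => ?_⟩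
  have hab : 0 < a + b := by positivity
  have := lintegral_exp_add_le (P := P) (U := fun ω => lam * Z ω) (V := fun ω => lam * W ω)
    (p := a / (a + b)) (q := b / (a + b))
    (x := Real.log 2 + (lam * (a + b)) ^ α / α + lam * (a + b) / a * m)
    (y := Real.log 2 + (lam * (a + b)) ^ α / α + lam * (a + b) / b * n)
    (h.1.const_mul _) (h'.1.const_mul _) (by positivity) (by positivity) (by field_simp)
    (by
      have e1 : ∀ ω, lam * Z ω / (a / (a + b)) = lam * (a + b) / a * Z ω := fun ω => by field_simp
      have e2 : lam * (a + b) = lam * (a + b) / a * a := by field_simp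
      simp only [e1]
      nth_rw 2 [e2]
      exact h.2 _ (by positivity))
    (by
      have e1 : ∀ ω, lam * W ω / (b / (a + b)) = lam * (a + b) / b * W ω := fun ω => by field_simp
      have e2 : lam * (a + b) = lam * (a + b) / b * b := by field_simp
      simp only [e1]
      nth_rw 2 [e2]
      exact h'.2 _ (by positivity))
  have e : ∀ z, a / (a + b) * (Real.log 2 + z / α + lam * (a + b) / a * m) +
      b / (a + b) * (Real.log 2 + z / α + lam * (a + b) / b * n) =
      Real.log 2 + z / α + lam * (m + n) := fun z => by
    generalize z / α = w
    field_simp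
    ring
  simpa only [mul_add lam (Z _), e] using this

theorem ExpTailBound.div {α a m r : ℝ} {Z : Ω → ℝ} (hr : 0 < r) (h : ExpTailBound α P Z a m) :
    ExpTailBound α P (fun ω => Z ω / r) (a / r) (m / r) := by
  refine ⟨h.1.div_const r, fun lam hlam => ?_⟩
  have e : ∀ x, lam * (x / r) = lam / r * x := fun x => by ring
  simpa only [e] using h.2 (lam / r) (by positivity)

theorem ExpTailBound.sum {α : ℝ} {a m : ℕ → ℝ} {Z : ℕ → Ω → ℝ} (ha : ∀ k, 0 < a k)
    (h : ∀ k, ExpTailBound α P (Z k) (a k) (m k)) (n : ℕ) :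
    ExpTailBound α P (fun ω => ∑ k ∈ Finset.range (n + 1), Z k ω)
      (∑ k ∈ Finset.range (n + 1), a k) (∑ k ∈ Finset.range (n + 1), m k) := by
  induction n with
  | zero => simpa using h 0
  | succ n ih =>
    simp only [Finset.sum_range_succ _ (n + 1)]
    exact ih.add (Finset.sum_pos (fun k _ => ha k) (by simp)) (ha _) (h _)

theorem ExpTailBound.of_tendsto {α a m : ℝ} {u v : ℕ → ℝ} {Z : Ω → ℝ} (hα : 0 < α)
    (hu : Tendsto u atTop (nhds a)) (hv : Tendsto v atTop (nhds m))
    (h : ∀ n, ExpTailBound α P Z (u n) (v n)) : ExpTailBound α P Z a m := by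
  refine ⟨(h 0).1, fun lam hlam => ?_⟩
  have h1 : Tendsto (fun n => (lam * u n) ^ α) atTop (nhds ((lam * a) ^ α)) :=
    (hu.const_mul lam).rpow_const (Or.inr hα.le)
  have h2 := ENNReal.tendsto_ofReal ((Real.continuous_exp.tendsto _).comp
    (((h1.div_const α).const_add (Real.log 2)).add (hv.const_mul lam)))
  exact ge_of_tendsto' h2 fun n => (h n).2 lam hlam

variable {ι : Type*}

theorem aemeasurable_maxAbs {F : Finset ι} {Y : ι → Ω → ℝ} (h : ∀ i ∈ F, AEMeasurable (Y i) P) :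
    AEMeasurable (maxAbs F Y) P := by
  have : AEMeasurable (F.sup fun i ω => ‖Y i ω‖₊) P :=
    Finset.sup_induction (p := fun g : Ω → NNReal => AEMeasurable g P) aemeasurable_const
      (fun _ h₁ _ h₂ => h₁.sup h₂) fun i hi => (h i hi).nnnorm
  refine this.coe_nnreal_real.congr (Eventually.of_forall fun ω => ?_)
  simp [maxAbs, Finset.sup_apply]

/-- The maximal inequality: a finite maximum of sub-Gaussian variables. -/
theorem expTailBound_maxAbs [IsProbabilityMeasure P] {α β a L : ℝ} (hαβ : α.HolderConjugate β)
    (ha : 0 < a) (hL : 0 ≤ L) {F : Finset ι} (hF : F.Nonempty) (hcard : (F.card : ℝ) ≤ Real.exp L)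
    {Y : ι → Ω → ℝ} (hY : ∀ i ∈ F, SubExpBound α P (Y i) a) :
    ExpTailBound α P (maxAbs F Y) a (2 * a * L ^ (1 / β)) := by
  have hα : 0 < α := hαβ.pos
  have hα1 : 1 ≤ α := hαβ.lt.le
  have hm := aemeasurable_maxAbs (P := P) fun i hi => (hY i hi).1
  refine ⟨hm, fun lam hlam => ?_⟩
  -- The union bound is taken at an exponent `s ≥ lam` for which `(s * a) ^ α` exceeds `(lam * a) ^
  -- α` by exactly `α * L`. The cardinality and this excess cost `L` each, and Lyapunov's power `lam
  -- / s` then reduces the total `2 * L` to the drift.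
  obtain ⟨s, hs0, hs⟩ : ∃ s : ℝ, 0 < s ∧ s ^ α = lam ^ α + α * L / a ^ α :=
    ⟨(lam ^ α + α * L / a ^ α) ^ (1 / α), by positivity, by
      rw [← Real.rpow_mul (by positivity), one_div_mul_cancel hα.ne', Real.rpow_one]⟩
  have hls : lam ≤ s := by
    refine (Real.rpow_le_rpow_iff hlam.le hs0.le hα).1 ?_
    rw [hs]
    have : 0 ≤ α * L / a ^ α := by positivity
    linarith
  have hsa : (s * a) ^ α = (lam * a) ^ α + α * L := by
    rw [Real.mul_rpow hs0.le ha.le, hs, Real.mul_rpow hlam.le ha.le]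
    field_simp
  -- From `(s * a) ^ α ≥ α * L ≥ L` one gets `L ^ (1 / α) ≤ s * a`; the other factor of `L` is `L ^
  -- (1 / β)`.
  have hLs : L ≤ s * (a * L ^ (1 / β)) := by
    have h1 : L ^ (1 / α) ≤ s * a := by
      refine (Real.rpow_le_rpow_iff (by positivity) (by positivity) hα).1 ?_
      rw [← Real.rpow_mul hL, one_div_mul_cancel hα.ne', Real.rpow_one, hsa]
      have : 0 ≤ (lam * a) ^ α := by positivity
      nlinarith
    have h2 : L = L ^ (1 / α) * L ^ (1 / β) := by
      have h3 : 1 / α + 1 / β = 1 := by simpa using hαβ.inv_add_inv_eq_one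
      rw [← Real.rpow_add_of_nonneg hL (by positivity) (one_div_nonneg.2 hαβ.symm.pos.le), h3,
        Real.rpow_one]
    calc L = L ^ (1 / α) * L ^ (1 / β) := h2
      _ ≤ s * a * L ^ (1 / β) := by gcongr
      _ = _ := by ring
  have hs' : ∫⁻ ω, ENNReal.ofReal (Real.exp (s * maxAbs F Y ω)) ∂P ≤
      ENNReal.ofReal (Real.exp (Real.log 2 + (lam * a) ^ α / α + 2 * L)) := by
    have hmi : ∀ i ∈ F, ∀ r : ℝ,
        AEMeasurable (fun ω => ENNReal.ofReal (Real.exp (r * Y i ω))) P := fun i hi r =>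
      (Real.measurable_exp.comp_aemeasurable ((hY i hi).1.const_mul r)).ennreal_ofReal
    calc ∫⁻ ω, ENNReal.ofReal (Real.exp (s * maxAbs F Y ω)) ∂P
        ≤ ∫⁻ ω, ∑ i ∈ F, (ENNReal.ofReal (Real.exp (s * Y i ω)) +
            ENNReal.ofReal (Real.exp (-s * Y i ω))) ∂P := by
          refine lintegral_mono fun ω => ?_
          obtain ⟨i, hi, h⟩ := exists_maxAbs_eq hF Y ω
          refine le_trans ?_ (Finset.single_le_sum (fun _ _ => zero_le) hi)
          rw [h]
          rcases abs_cases (Y i ω) with ⟨h, -⟩ | ⟨h, -⟩ <;> rw [h]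
          · exact le_self_add
          · rw [mul_neg, ← neg_mul]
            exact le_add_self
      _ = ∑ i ∈ F, (∫⁻ ω, ENNReal.ofReal (Real.exp (s * Y i ω)) ∂P +
            ∫⁻ ω, ENNReal.ofReal (Real.exp (-s * Y i ω)) ∂P) := by
          refine (lintegral_finsetSum' _ fun i hi => (hmi i hi s).add (hmi i hi (-s))).trans ?_
          exact Finset.sum_congr rfl fun i hi => lintegral_add_left' (hmi i hi s) _
      _ ≤ ∑ i ∈ F, (ENNReal.ofReal (Real.exp ((s * a) ^ α / α)) +
            ENNReal.ofReal (Real.exp ((s * a) ^ α / α))) := by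
          refine Finset.sum_le_sum fun i hi => ?_
          have e : ∀ r : ℝ, |r| = s → phi α (r * a) = (s * a) ^ α / α := fun r hr => by
            rw [phi, abs_mul, hr, abs_of_pos ha]
          have h1 := (hY i hi).2 s
          have h2 := (hY i hi).2 (-s)
          rw [e s (abs_of_pos hs0)] at h1
          rw [e (-s) (by rw [abs_neg, abs_of_pos hs0])] at h2
          exact add_le_add h1 h2
      _ = ENNReal.ofReal (F.card * (2 * Real.exp ((s * a) ^ α / α))) := by
          rw [Finset.sum_const, nsmul_eq_mul, ENNReal.ofReal_mul (by positivity),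
            ENNReal.ofReal_natCast, two_mul,
            ENNReal.ofReal_add (Real.exp_pos _).le (Real.exp_pos _).le]
      _ ≤ _ := by
          refine ENNReal.ofReal_le_ofReal ?_
          calc F.card * (2 * Real.exp ((s * a) ^ α / α))
              ≤ Real.exp L * (2 * Real.exp ((s * a) ^ α / α)) := by gcongr
            _ = Real.exp (Real.log 2 + (lam * a) ^ α / α + 2 * L) := by
              rw [show Real.log 2 + (lam * a) ^ α / α + 2 * L
                  = L + (Real.log 2 + (s * a) ^ α / α) by rw [hsa]; field_simp; ring,
                Real.exp_add, Real.exp_add, Real.exp_log two_pos]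
  have hp1 : lam / s ≤ 1 := (div_le_one hs0).2 hls
  have := lintegral_exp_mul_le (P := P) (hm.const_mul s) (div_pos hlam hs0) hp1 hs'
  have e : ∀ ω, lam / s * (s * maxAbs F Y ω) = lam * maxAbs F Y ω := fun ω => by field_simp
  simp only [e] at this
  refine this.trans (ENNReal.ofReal_le_ofReal (Real.exp_le_exp.2 ?_))
  have h1 : lam / s * (Real.log 2 + (lam * a) ^ α / α) ≤ 1 * (Real.log 2 + (lam * a) ^ α / α) := by
    have : 0 ≤ Real.log 2 := Real.log_nonneg one_le_two
    gcongr
  have h2 : lam / s * L ≤ lam / s * (s * (a * L ^ (1 / β))) := by gcongr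
  have h3 : lam / s * (s * (a * L ^ (1 / β))) = lam * (a * L ^ (1 / β)) := by field_simp
  linarith

end ExpMoments

/-! ### From `tau` to moment bounds. -/

section Tau

variable {Ω : Type*} [MeasurableSpace Ω] {P : Measure Ω}

theorem SubExpBound.integrable_and_le {α a : ℝ} {ζ : Ω → ℝ} (h : SubExpBound α P ζ a) (lam : ℝ) :
    Integrable (fun ω => Real.exp (lam * ζ ω)) P ∧
      ∫ ω, Real.exp (lam * ζ ω) ∂P ≤ Real.exp (phi α (a * lam)) := by
  have hm : AEMeasurable (fun ω => Real.exp (lam * ζ ω)) P :=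
    Real.measurable_exp.comp_aemeasurable (h.1.const_mul lam)
  have h0 : 0 ≤ᵐ[P] fun ω => Real.exp (lam * ζ ω) :=
    Eventually.of_forall fun ω => (Real.exp_pos _).le
  have hi : Integrable (fun ω => Real.exp (lam * ζ ω)) P :=
    (lintegral_ofReal_ne_top_iff_integrable hm.aestronglyMeasurable h0).1
      ((h.2 lam).trans_lt ENNReal.ofReal_lt_top).ne
  refine ⟨hi, ?_⟩
  rw [← ENNReal.ofReal_le_ofReal_iff (Real.exp_pos _).le, ofReal_integral_eq_lintegral_ofReal hi h0,
    mul_comm a]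
  exact h.2 lam

theorem subExpBound_of_integral_le {α a : ℝ} {ζ : Ω → ℝ} (hζ : AEMeasurable ζ P)
    (h : ∀ lam : ℝ, Integrable (fun ω => Real.exp (lam * ζ ω)) P ∧
      ∫ ω, Real.exp (lam * ζ ω) ∂P ≤ Real.exp (phi α (a * lam))) : SubExpBound α P ζ a := by
  refine ⟨hζ, fun lam => ?_⟩
  rw [← ofReal_integral_eq_lintegral_ofReal (h lam).1
    (Eventually.of_forall fun ω => (Real.exp_pos _).le), mul_comm lam a]
  exact ENNReal.ofReal_le_ofReal (h lam).2

theorem IsPhiSubGaussian.exists_subExpBound {α : ℝ} {ζ : Ω → ℝ}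
    (h : IsPhiSubGaussian (phi α) P ζ) : ∃ a : ℝ, 0 < a ∧ SubExpBound α P ζ a := by
  obtain ⟨a, ha, hb⟩ := h.bound
  exact ⟨a, ha, subExpBound_of_integral_le h.aemeasurable fun lam =>
    ⟨h.integrable_exp lam, by rw [mul_comm a]; exact hb lam⟩⟩

/-- An infimum over the empty set would be 0, so a bound on `tau` of an increment says something
only once some admissible constant is known to exist. -/
theorem IsPhiSubGaussian.exists_subExpBound_sub {α : ℝ} {ζ ξ : Ω → ℝ}
    (h : IsPhiSubGaussian (phi α) P ζ) (h' : IsPhiSubGaussian (phi α) P ξ) :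
    ∃ a : ℝ, 0 < a ∧ SubExpBound α P (fun ω => ζ ω - ξ ω) a := by
  obtain ⟨a, ha, hζ⟩ := h.exists_subExpBound
  obtain ⟨b, hb, hξ⟩ := h'.exists_subExpBound
  exact ⟨a + b, by positivity, by simpa only [sub_eq_add_neg] using hζ.add ha hb hξ.neg⟩

/-- The infimum in the definition of `tau` is attained, up to the positivity of the constant. -/
theorem subExpBound_of_tau_le {α a : ℝ} {ζ : Ω → ℝ} (hα : 0 < α)
    (h : ∃ a : ℝ, 0 < a ∧ SubExpBound α P ζ a) (ha : tau (phi α) P ζ ≤ a) :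
    SubExpBound α P ζ a := by
  obtain ⟨c, hc, hζ⟩ := h
  refine SubExpBound.of_forall_gt hα fun b hb => ?_
  have hlt := ha.trans_lt hb
  unfold tau at hlt
  obtain ⟨d, ⟨hd, hd'⟩, hdb⟩ := exists_lt_of_csInf_lt (by exact ⟨c, hc, hζ.integrable_and_le⟩) hlt
  exact (subExpBound_of_integral_le hζ.1 hd').mono hα hd.le hdb.le

end Tau

/-! ### Chaining along nets. -/

section Chaining

variable {Ω : Type*} [MeasurableSpace Ω] {P : Measure Ω} [IsProbabilityMeasure P]
  {E : Type*} {T : Set E} {X : E → Ω → ℝ} {α β θ ε : ℝ}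

/-- Finitely many steps of chaining along a sequence of nets. -/
theorem expTailBound_maxAbs_chain (hαβ : α.HolderConjugate β) (hθ : 0 < θ) (hε : 0 < ε)
    (hX : ∀ t ∈ T, SubExpBound α P (X t) ε) {S : ℕ → Finset E} (hST : ∀ n, ∀ t ∈ S n, t ∈ T)
    (hS : ∀ n, (S n).Nonempty) {L : ℕ → ℝ} (hL : ∀ n, 0 ≤ L n)
    (hcard : ∀ n, ((S n).card : ℝ) ≤ Real.exp (L n))
    (hnet : ∀ n, ∀ t ∈ T, ∃ s ∈ S n,
      SubExpBound α P (fun ω => X t ω - X s ω) (θ ^ (n + 1) * ε))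
    (n : ℕ) (F : Finset E) (hFT : ∀ t ∈ F, t ∈ T) (hF : F.Nonempty) {M : ℝ} (hM : 0 ≤ M)
    (hFM : (F.card : ℝ) ≤ Real.exp M) :
    ExpTailBound α P (maxAbs F X) (∑ i ∈ Finset.range (n + 1), θ ^ i * ε)
      (∑ i ∈ Finset.range n, 2 * (θ ^ i * ε) * L i ^ (1 / β) +
        2 * (θ ^ n * ε) * M ^ (1 / β)) := by
  induction n generalizing F M with
  | zero =>
    simpa using expTailBound_maxAbs hαβ hε hM hF hFM fun t ht => hX t (hFT t ht)
  | succ n ih =>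
    have hgex : ∀ t, ∃ s, t ∈ T → s ∈ S n ∧
        SubExpBound α P (fun ω => X t ω - X s ω) (θ ^ (n + 1) * ε) := fun t => by
      by_cases ht : t ∈ T
      · obtain ⟨s, hs, h⟩ := hnet n t ht
        exact ⟨s, fun _ => ⟨hs, h⟩⟩
      · exact ⟨t, fun h => absurd h ht⟩
    choose g hg using hgex
    have h1 := expTailBound_maxAbs (P := P) hαβ (a := θ ^ (n + 1) * ε) (by positivity) hM hF hFM
      (Y := fun t ω => X t ω - X (g t) ω) fun t ht => (hg t (hFT t ht)).2
    -- The chain is peeled off at its finest link: the net `S n` takes over the role of `F`, and the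
    -- maximum over `F` is at most the maximum over `S n` plus that of the links `X t - X (g t)`, of
    -- which there is one for each point of `F`.
    have h2 := ih (S n) (hST n) (hS n) (hL n) (hcard n)
    have hpos : 0 < ∑ i ∈ Finset.range (n + 1), θ ^ i * ε :=
      Finset.sum_pos (fun i _ => by positivity) (by simp)
    refine (h2.add hpos (by positivity) h1).mono hαβ.pos
      (aemeasurable_maxAbs fun t ht => (hX t (hFT t ht)).1) (fun ω => ?_) (by positivity)
      (Finset.sum_range_succ _ (n + 1)).ge ?_
    · obtain ⟨t, ht, h⟩ := exists_maxAbs_eq hF X ω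
      have h3 := abs_le_maxAbs X ω (hg t (hFT t ht)).1
      have h4 := abs_le_maxAbs (fun t ω => X t ω - X (g t) ω) ω ht
      have h5 := abs_add_le (X (g t) ω) (X t ω - X (g t) ω)
      rw [add_sub_cancel] at h5
      rw [h]
      exact h5.trans (add_le_add h3 h4)
    · rw [Finset.sum_range_succ _ n]

/-- The chaining bound for a field over a set with a sequence of nets. -/
theorem expTailBound_maxAbs_of_nets (hαβ : α.HolderConjugate β) (hθ : 0 < θ) (hθ1 : θ < 1)
    (hε : 0 < ε) (hX : ∀ t ∈ T, SubExpBound α P (X t) ε) {S : ℕ → Finset E}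
    (hST : ∀ n, ∀ t ∈ S n, t ∈ T) (hS : ∀ n, (S n).Nonempty) {L : ℕ → ℝ} (hL : ∀ n, 0 ≤ L n)
    (hcard : ∀ n, ((S n).card : ℝ) ≤ Real.exp (L n))
    (hnet : ∀ n, ∀ t ∈ T, ∃ s ∈ S n,
      SubExpBound α P (fun ω => X t ω - X s ω) (θ ^ (n + 1) * ε))
    {m : ℝ} (hm : ∀ n, ∑ i ∈ Finset.range n, 2 * (θ ^ i * ε) * L i ^ (1 / β) ≤ m)
    (F : Finset E) (hFT : ∀ t ∈ F, t ∈ T) (hF : F.Nonempty) :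
    ExpTailBound α P (maxAbs F X) (ε / (1 - θ)) m := by
  have hcF : (1 : ℝ) ≤ F.card := by exact_mod_cast hF.card_pos
  -- Only the last link sees the cardinality of `F`, and its scale `θ ^ n * ε` tends to 0; the limit
  -- in `n` makes the bound independent of `F`.
  have hlim : Tendsto (fun n => m + 2 * (θ ^ n * ε) * Real.log F.card ^ (1 / β)) atTop (nhds m) := by
    have := (((tendsto_pow_atTop_nhds_zero_of_lt_one hθ.le hθ1).mul_const ε).const_mul
      2).mul_const (Real.log F.card ^ (1 / β)) |>.const_add m
    simpa using this
  refine ExpTailBound.of_tendsto hαβ.pos tendsto_const_nhds hlim fun n => ?_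
  have h := expTailBound_maxAbs_chain (P := P) hαβ hθ hε hX hST hS hL hcard hnet n F hFT hF
    (Real.log_nonneg hcF) (Real.exp_log (by linarith)).ge
  refine h.mono hαβ.pos h.1 (fun _ => le_rfl) (Finset.sum_nonneg fun i _ => by positivity) ?_
    (by have := hm n; linarith)
  rw [← Finset.sum_mul, mul_comm, div_eq_mul_inv]
  gcongr
  rw [← tsum_geometric_of_lt_one hθ.le hθ1]
  exact (summable_geometric_of_lt_one hθ.le hθ1).sum_le_tsum _ fun i _ => by positivity

end Chaining

/-! ### Nets of rectangles and their entropy. -/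

section Entropy

/-- A grid of the interval `[x, x + l]` with mesh at most `r`. -/
theorem exists_grid {x l r : ℝ} (hl : 0 ≤ l) (hr : 0 < r) :
    ∃ S : Finset ℝ, S.Nonempty ∧ (∀ s ∈ S, s ∈ Icc x (x + l)) ∧ (S.card : ℝ) ≤ 1 + l / 2 / r ∧
      ∀ t ∈ Icc x (x + l), ∃ s ∈ S, |t - s| ≤ r := by
  rcases hl.eq_or_lt with rfl | hl
  · refine ⟨{x}, by simp, by simp, by simp, fun t ht => ⟨x, by simp, ?_⟩⟩
    obtain rfl : t = x := le_antisymm (by simpa using ht.2) ht.1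
    simpa using hr.le
  -- The net consists of the midpoints of `K + 1` equal cells, so the mesh is half a cell; this is
  -- where `l / 2` comes from.
  set K := ⌊l / 2 / r⌋₊ with hK
  set N : ℝ := K + 1 with hN
  have hN0 : 0 < N := by positivity
  have hNr : l / (2 * N) ≤ r := by
    have := (Nat.lt_floor_add_one (l / 2 / r)).le
    rw [div_le_iff₀ hr] at this
    rw [div_le_iff₀ (by positivity)]
    linarith
  have hmem : ∀ i : ℕ, i ≤ K → x + l * (2 * i + 1) / (2 * N) ∈ Icc x (x + l) := fun i hi => by
    have hi' : (i : ℝ) ≤ K := by exact_mod_cast hi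
    refine ⟨by have : 0 ≤ l * (2 * i + 1) / (2 * N) := by positivity
               linarith, ?_⟩
    have : l * (2 * i + 1) / (2 * N) ≤ l := by
      rw [div_le_iff₀ (by positivity)]
      have : (2 * i + 1 : ℝ) ≤ 2 * N := by linarith
      gcongr
    linarith
  refine ⟨(Finset.range (K + 1)).image fun i : ℕ => x + l * (2 * i + 1) / (2 * N),
    by simp, ?_, ?_, fun t ht => ?_⟩
  · intro s hs
    obtain ⟨i, hi, rfl⟩ := Finset.mem_image.1 hs
    exact hmem i (Nat.lt_succ_iff.1 (Finset.mem_range.1 hi))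
  · have h1 : (((Finset.range (K + 1)).image
        fun i : ℕ => x + l * (2 * i + 1) / (2 * N)).card : ℝ) ≤ (K + 1 : ℕ) := by
      exact_mod_cast Finset.card_image_le.trans (Finset.card_range _).le
    have h2 : (K : ℝ) ≤ l / 2 / r := Nat.floor_le (by positivity)
    push_cast at h1
    linarith
  · set y := (t - x) * N / l with hy
    have hy0 : 0 ≤ y := by
      have := ht.1
      have : 0 ≤ t - x := by linarith
      positivity
    have hyN : y ≤ N := by
      rw [hy, div_le_iff₀ hl, mul_comm]
      have := ht.2
      gcongr
      linarith
    obtain ⟨i, hi, h1, h2⟩ : ∃ i : ℕ, i ≤ K ∧ (i : ℝ) ≤ y ∧ y ≤ i + 1 := by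
      -- At the right end point the floor is `K + 1`; that point is assigned to the last cell.
      rcases le_total ⌊y⌋₊ K with h | h
      · exact ⟨⌊y⌋₊, h, Nat.floor_le hy0, (Nat.lt_floor_add_one y).le⟩
      · exact ⟨K, le_rfl, (by exact_mod_cast h : (K : ℝ) ≤ ⌊y⌋₊).trans (Nat.floor_le hy0), hyN⟩
    refine ⟨_, Finset.mem_image.2 ⟨i, Finset.mem_range.2 (Nat.lt_succ_iff.2 hi), rfl⟩, ?_⟩
    have e : t - (x + l * (2 * i + 1) / (2 * N)) = l / (2 * N) * (2 * (y - i) - 1) := by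
      rw [hy]
      field_simp
      ring
    rw [e, abs_mul, abs_of_pos (by positivity)]
    calc l / (2 * N) * |2 * (y - i) - 1| ≤ l / (2 * N) * 1 := by
          gcongr
          rw [abs_le]
          constructor <;> linarith
      _ ≤ r := by linarith

/-- Subadditivity of the power `H ≤ 1` gives H log(1+x) = log (1+x)^H ≤ log(1+x^H) ≤ x^H. -/
theorem log_one_add_le_rpow_div {x H : ℝ} (hx : 0 ≤ x) (hH : 0 < H) (hH1 : H ≤ 1) :
    Real.log (1 + x) ≤ x ^ H / H := by
  rw [le_div_iff₀ hH, mul_comm, ← Real.log_rpow (by positivity)]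
  have h1 : (1 + x) ^ H ≤ 1 + x ^ H := by
    simpa using Real.rpow_add_le_add_rpow zero_le_one hx hH.le hH1
  have h2 := Real.log_le_sub_one_of_pos (x := (1 + x) ^ H) (by positivity)
  linarith

theorem log_one_add_rpow_le {y h H β : ℝ} (hy : 0 ≤ y) (hh : 0 < h) (hH : 0 < H) (hH1 : H ≤ 1)
    (hβ : 1 ≤ β) :
    Real.log (1 + y / (h / 2) ^ (1 / H)) ^ (1 / β) ≤
      1 / H * y ^ (H / β) * (2 ^ (1 / β) * h ^ (-(1 / β))) := by
  have hβ0 : 0 < β := by linarith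
  have h1 := log_one_add_le_rpow_div (x := y / (h / 2) ^ (1 / H)) (by positivity) hH hH1
  have e1 : (y / (h / 2) ^ (1 / H)) ^ H / H = 1 / H * (y ^ H * (2 * h⁻¹)) := by
    rw [Real.div_rpow hy (by positivity), ← Real.rpow_mul (by positivity),
      one_div_mul_cancel hH.ne', Real.rpow_one]
    field_simp
  rw [e1] at h1
  -- Since `1 / H ≥ 1`, raising it to the power `β` is a loss that makes the later root of order `β`
  -- return exactly the factor `1 / H` of `cOne`.
  have h2 : 1 / H * (y ^ H * (2 * h⁻¹)) ≤ (1 / H) ^ β * (y ^ H * (2 * h⁻¹)) := by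
    gcongr
    exact Real.self_le_rpow_of_one_le ((one_le_div hH).2 hH1) hβ
  calc _ ≤ ((1 / H) ^ β * (y ^ H * (2 * h⁻¹))) ^ (1 / β) := by
        refine Real.rpow_le_rpow (Real.log_nonneg ?_) (h1.trans h2) (by positivity)
        have : 0 ≤ y / (h / 2) ^ (1 / H) := by positivity
        linarith
    _ = _ := by
        rw [Real.mul_rpow (by positivity) (by positivity),
          Real.mul_rpow (by positivity) (by positivity),
          Real.mul_rpow (by positivity) (by positivity), ← Real.rpow_mul (by positivity),
          mul_one_div_cancel hβ0.ne', Real.rpow_one, ← Real.rpow_mul hy, mul_one_div,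
          Real.inv_rpow hh.le, ← Real.rpow_neg hh.le, mul_assoc]

/-- Nets of the rectangle `[x, x + l] × [-A, A]` in the anisotropic metric. -/
theorem exists_net {H₁ H₂ A x l h : ℝ} (hH₁ : 0 < H₁) (hH₂ : 0 < H₂) (hA : 0 ≤ A) (hl : 0 ≤ l)
    (hh : 0 < h) :
    ∃ S : Finset (ℝ × ℝ), S.Nonempty ∧ (∀ s ∈ S, s ∈ Icc x (x + l) ×ˢ Icc (-A) A) ∧
      (S.card : ℝ) ≤ Real.exp (Real.log (1 + l / 2 / (h / 2) ^ (1 / H₁)) +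
        Real.log (1 + A / (h / 2) ^ (1 / H₂))) ∧
      ∀ t ∈ Icc x (x + l) ×ˢ Icc (-A) A, ∃ s ∈ S, dist2 H₁ H₂ t s ≤ h := by
  obtain ⟨S₁, hn₁, hS₁, hc₁, hd₁⟩ := exists_grid (x := x) hl (r := (h / 2) ^ (1 / H₁))
    (by positivity)
  obtain ⟨S₂, hn₂, hS₂, hc₂, hd₂⟩ := exists_grid (x := -A) (l := 2 * A) (by positivity)
    (r := (h / 2) ^ (1 / H₂)) (by positivity)
  have e : -A + 2 * A = A := by ring
  rw [e] at hS₂ hd₂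
  rw [mul_div_cancel_left₀ _ two_ne_zero] at hc₂
  refine ⟨S₁ ×ˢ S₂, hn₁.product hn₂, fun s hs => ?_, ?_, fun t ht => ?_⟩
  · rw [Finset.mem_product] at hs
    exact ⟨hS₁ _ hs.1, hS₂ _ hs.2⟩
  · rw [Real.exp_add, Real.exp_log (by positivity), Real.exp_log (by positivity),
      Finset.card_product]
    push_cast
    gcongr
  · obtain ⟨s₁, hs₁, h₁⟩ := hd₁ t.1 ht.1
    obtain ⟨s₂, hs₂, h₂⟩ := hd₂ t.2 ht.2
    refine ⟨(s₁, s₂), Finset.mem_product.2 ⟨hs₁, hs₂⟩, ?_⟩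
    have key : ∀ {z H : ℝ}, 0 < H → |z| ≤ (h / 2) ^ (1 / H) → |z| ^ H ≤ h / 2 := by
      intro z H hH hz
      refine (Real.rpow_le_rpow (abs_nonneg _) hz hH.le).trans_eq ?_
      rw [← Real.rpow_mul (by positivity), one_div_mul_cancel hH.ne', Real.rpow_one]
    have := add_le_add (key hH₁ h₁) (key hH₂ h₂)
    unfold dist2
    linarith

/-- The entropy bound for the nets of `exists_net`. -/
theorem entropy_rpow_le {H₁ H₂ A l h β : ℝ} (hH₁ : 0 < H₁) (hH₁1 : H₁ ≤ 1) (hH₂ : 0 < H₂)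
    (hH₂1 : H₂ ≤ 1) (hA : 0 ≤ A) (hl : 0 ≤ l) (hh : 0 < h) (hβ : 1 ≤ β) :
    (Real.log (1 + l / 2 / (h / 2) ^ (1 / H₁)) +
      Real.log (1 + A / (h / 2) ^ (1 / H₂))) ^ (1 / β) ≤
      (1 / H₁ * (l / 2) ^ (H₁ / β) + 1 / H₂ * A ^ (H₂ / β)) *
        (2 ^ (1 / β) * h ^ (-(1 / β))) := by
  have h0 : ∀ {y : ℝ}, 0 ≤ y → 0 ≤ Real.log (1 + y) := fun hy =>
    Real.log_nonneg (by linarith)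
  have h1 := log_one_add_rpow_le (y := l / 2) (by positivity) hh hH₁ hH₁1 hβ
  have h2 := log_one_add_rpow_le hA hh hH₂ hH₂1 hβ
  refine (Real.rpow_add_le_add_rpow (h0 (by positivity)) (h0 (by positivity)) (by positivity)
    ((div_le_one (by linarith)).2 hβ)).trans ?_
  linarith

/-- The geometric sum that replaces the entropy integral. -/
theorem sum_geometric_rpow_le {θ ε κ G : ℝ} (hθ : 0 < θ) (hθ1 : θ < 1) (hε : 0 < ε)
    (hκ1 : κ < 1) (hκ : 0 ≤ κ) (hG : 0 ≤ G) (n : ℕ) :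
    ∑ i ∈ Finset.range n, 2 * (θ ^ i * ε) * (G * (θ ^ (i + 1) * ε) ^ (-κ)) ≤
      2 / ((1 - θ) * θ ^ κ) * (ε ^ (1 - κ) * (G / (1 - κ))) := by
  set q := θ ^ (1 - κ) with hq
  have hq0 : 0 ≤ q := by positivity
  have hκ' : 0 < 1 - κ := by linarith
  -- Bernoulli's inequality for the concave power `1 - κ`; it turns `1 / (1 - q)` into the factors
  -- `1 / (1 - κ)` and `1 / (1 - θ)`.
  have hq1 : q ≤ 1 - (1 - κ) * (1 - θ) := by
    have := rpow_one_add_le_one_add_mul_self (s := θ - 1) (by linarith) hκ'.le (by linarith)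
    rw [add_sub_cancel] at this
    linarith
  have hθ' : 0 < 1 - θ := by linarith
  have hpos : 0 < (1 - κ) * (1 - θ) := by positivity
  have hterm : ∀ i : ℕ, 2 * (θ ^ i * ε) * (G * (θ ^ (i + 1) * ε) ^ (-κ)) =
      2 * G * ε ^ (1 - κ) / θ ^ κ * q ^ i := fun i => by
    rw [Real.mul_rpow (by positivity) hε.le, pow_succ, Real.mul_rpow (by positivity) hθ.le, hq,
      ← Real.rpow_natCast (θ ^ (1 - κ)), ← Real.rpow_mul hθ.le, mul_comm (1 - κ) (i : ℝ),
      Real.rpow_mul hθ.le, Real.rpow_natCast, Real.rpow_sub (by positivity : 0 < θ ^ i),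
      Real.rpow_sub hε, Real.rpow_one, Real.rpow_one, Real.rpow_neg (by positivity),
      Real.rpow_neg hθ.le, Real.rpow_neg hε.le]
    field_simp
  simp only [hterm]
  rw [← Finset.mul_sum]
  have hsum : ∑ i ∈ Finset.range n, q ^ i ≤ ((1 - κ) * (1 - θ))⁻¹ := by
    have hq1' : q < 1 := by linarith
    calc ∑ i ∈ Finset.range n, q ^ i ≤ ∑' i, q ^ i :=
          (summable_geometric_of_lt_one hq0 hq1').sum_le_tsum _ fun i _ => by positivity
      _ = (1 - q)⁻¹ := tsum_geometric_of_lt_one hq0 hq1'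
      _ ≤ _ := by
          gcongr
          linarith
  calc _ ≤ 2 * G * ε ^ (1 - κ) / θ ^ κ * ((1 - κ) * (1 - θ))⁻¹ := by gcongr
    _ = _ := by
        field_simp

end Entropy

/-! ### From one block to the whole domain. -/

section Field

variable {Ω : Type*} [MeasurableSpace Ω] {P : Measure Ω}

/-- The maximal bound on one rectangle. -/
theorem expTailBound_maxAbs_rectangle [IsProbabilityMeasure P] {X : ℝ × ℝ → Ω → ℝ}
    {α β γ θ ε H₁ H₂ A x l c : ℝ} (hαβ : α.HolderConjugate β) (hγ : 0 < γ) (hγβ : 1 < γ * β)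
    (hH₁ : 0 < H₁) (hH₁1 : H₁ ≤ 1) (hH₂ : 0 < H₂) (hH₂1 : H₂ ≤ 1) (hA : 0 ≤ A) (hl : 0 ≤ l)
    (hθ : 0 < θ) (hθ1 : θ < 1) (hε : 0 < ε) (hc : 0 < c)
    (hX : ∀ t ∈ Icc x (x + l) ×ˢ Icc (-A) A, SubExpBound α P (X t) ε)
    (hincr : ∀ h : ℝ, 0 < h → ∀ t ∈ Icc x (x + l) ×ˢ Icc (-A) A,
      ∀ s ∈ Icc x (x + l) ×ˢ Icc (-A) A, dist2 H₁ H₂ t s ≤ h →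
        SubExpBound α P (fun ω => X t ω - X s ω) (c * h ^ γ))
    (F : Finset (ℝ × ℝ)) (hFT : ∀ t ∈ F, t ∈ Icc x (x + l) ×ˢ Icc (-A) A) (hF : F.Nonempty) :
    ExpTailBound α P (maxAbs F X) (ε / (1 - θ)) (2 / ((1 - θ) * θ ^ (1 / (γ * β))) *
      (ε ^ (1 - 1 / (γ * β)) *
        ((1 / H₁ * (l / 2) ^ (H₁ / β) + 1 / H₂ * A ^ (H₂ / β)) *
          (2 ^ (1 / β) * c ^ (1 / (γ * β)) / (1 - 1 / (γ * β)))))) := by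
  have hβ : 1 ≤ β := hαβ.symm.lt.le
  have hβ0 : 0 < β := hαβ.symm.pos
  have hκ1 : 1 / (γ * β) < 1 := (div_lt_one (by positivity)).2 hγβ
  have hκ0 : 0 ≤ 1 / (γ * β) := by positivity
  -- The radius at which the increment bound `c * h ^ γ` equals the accuracy `θ ^ (n + 1) * ε`
  -- required by the chaining.
  set h : ℕ → ℝ := fun n => (θ ^ (n + 1) * ε / c) ^ (1 / γ) with hh
  have hpos : ∀ n, 0 < h n := fun n => by positivity
  have hch : ∀ n, c * h n ^ γ = θ ^ (n + 1) * ε := fun n => by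
    rw [hh, ← Real.rpow_mul (by positivity), one_div_mul_cancel hγ.ne', Real.rpow_one]
    field_simp
  choose S hS hST hcard hnet using fun n =>
    exists_net (x := x) hH₁ hH₂ hA hl (hpos n)
  have hent : ∀ n, (Real.log (1 + l / 2 / (h n / 2) ^ (1 / H₁)) +
      Real.log (1 + A / (h n / 2) ^ (1 / H₂))) ^ (1 / β) ≤
      (1 / H₁ * (l / 2) ^ (H₁ / β) + 1 / H₂ * A ^ (H₂ / β)) *
        (2 ^ (1 / β) * c ^ (1 / (γ * β))) * (θ ^ (n + 1) * ε) ^ (-(1 / (γ * β))) := fun n => by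
    refine (entropy_rpow_le hH₁ hH₁1 hH₂ hH₂1 hA hl (hpos n) hβ).trans_eq ?_
    have e : h n ^ (-(1 / β)) =
        c ^ (1 / (γ * β)) * (θ ^ (n + 1) * ε) ^ (-(1 / (γ * β))) := by
      rw [hh, ← Real.rpow_mul (by positivity),
        show 1 / γ * -(1 / β) = -(1 / (γ * β)) by field_simp,
        Real.div_rpow (by positivity) hc.le, Real.rpow_neg hc.le (1 / (γ * β)), div_inv_eq_mul,
        mul_comm]
    rw [e]
    ring
  refine expTailBound_maxAbs_of_nets hαβ hθ hθ1 hε hX hST hS (fun n => ?_) hcard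
    (fun n t ht => ?_) (fun n => ?_) F hFT hF
  · have h1 : 0 ≤ l / 2 / (h n / 2) ^ (1 / H₁) := by have := hpos n; positivity
    have h2 : 0 ≤ A / (h n / 2) ^ (1 / H₂) := by have := hpos n; positivity
    exact add_nonneg (Real.log_nonneg (by linarith)) (Real.log_nonneg (by linarith))
  · obtain ⟨s, hs, hts⟩ := hnet n t ht
    exact ⟨s, hs, hch n ▸ hincr (h n) (hpos n) t ht s (hST n s hs) hts⟩
  · calc _ ≤ ∑ i ∈ Finset.range n, 2 * (θ ^ i * ε) *
          ((1 / H₁ * (l / 2) ^ (H₁ / β) + 1 / H₂ * A ^ (H₂ / β)) *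
            (2 ^ (1 / β) * c ^ (1 / (γ * β))) * (θ ^ (i + 1) * ε) ^ (-(1 / (γ * β)))) := by
          gcongr with i hi
          exact hent i
      _ ≤ _ := sum_geometric_rpow_le hθ hθ1 hε hκ1 hκ0 (by positivity) n
      _ = _ := by rw [mul_div_assoc]

theorem exists_mem_block {A : ℝ} {b : ℕ → ℝ} (hb0 : b 0 = 0) (hbtop : Tendsto b atTop atTop)
    {t : ℝ × ℝ} (ht : t ∈ domainV A) : ∃ k, t ∈ block A b k := by
  have hex : ∃ n, t.1 < b n := (hbtop.eventually_gt_atTop t.1).exists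
  have h0 : Nat.find hex ≠ 0 := fun h => by
    have := Nat.find_spec hex
    rw [h, hb0] at this
    exact absurd ht.1 (not_le.2 this)
  obtain ⟨k, hk⟩ := Nat.exists_eq_succ_of_ne_zero h0
  refine ⟨k, ⟨not_lt.1 (Nat.find_min hex (m := k) (by omega)), ?_⟩, ht.2⟩
  have := Nat.find_spec hex
  rw [hk] at this
  exact this.le

/-- Maximal bounds on all blocks add up to a bound on the whole domain. -/
theorem expTailBound_maxAbs_domain {X : ℝ × ℝ → Ω → ℝ} {α A C M : ℝ} {f : ℝ → ℝ} {b : ℕ → ℝ}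
    {a m : ℕ → ℝ} (hα : 0 < α) (hA : 0 ≤ A) (hfpos : ∀ t, 0 ≤ t → 0 < f t)
    (hfmono : MonotoneOn f (Ici 0)) (hb0 : b 0 = 0) (hbmono : ∀ k, b k < b (k + 1))
    (hbtop : Tendsto b atTop atTop) (hX : ∀ t ∈ domainV A, AEMeasurable (X t) P)
    (ha : ∀ k, 0 < a k) (hm : ∀ k, 0 ≤ m k)
    (hblock : ∀ k (F : Finset (ℝ × ℝ)), (∀ t ∈ F, t ∈ block A b k) → F.Nonempty →
      ExpTailBound α P (maxAbs F X) (a k) (m k))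
    (hC : HasSum (fun k => a k / f (b k)) C) (hM : HasSum (fun k => m k / f (b k)) M)
    (F : Finset (ℝ × ℝ)) (hF : F.Nonempty) (hFV : ∀ t ∈ F, t ∈ domainV A) :
    ExpTailBound α P (maxAbs F fun t ω => X t ω / f t.1) C M := by
  classical
  have hb : Monotone b := monotone_nat_of_le_succ fun k => (hbmono k).le
  have hbk : ∀ k, 0 ≤ b k := fun k => hb0 ▸ hb k.zero_le
  have hfb : ∀ k, 0 < f (b k) := fun k => hfpos _ (hbk k)
  -- The extra point of the block keeps `B k` nonempty even when `F` misses the block.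
  set B : ℕ → Finset (ℝ × ℝ) := fun k => insert (b k, 0) (F.filter (· ∈ block A b k)) with hB
  have hBk : ∀ k, ∀ t ∈ B k, t ∈ block A b k := fun k t ht => by
    rcases Finset.mem_insert.1 ht with rfl | ht
    · exact ⟨⟨le_rfl, (hbmono k).le⟩, by simpa using hA, hA⟩
    · exact (Finset.mem_filter.1 ht).2
  have hex : ∀ t, ∃ k, t ∈ domainV A → t ∈ block A b k := fun t => by
    by_cases ht : t ∈ domainV A
    · obtain ⟨k, hk⟩ := exists_mem_block hb0 hbtop ht
      exact ⟨k, fun _ => hk⟩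
    · exact ⟨0, fun h => absurd h ht⟩
  choose κ hκ using hex
  -- Only the blocks up to the largest index met by `F` are summed; the partial sums are at most `C`
  -- and `M` because all terms are nonnegative.
  have hsum := ExpTailBound.sum (P := P) (α := α) (Z := fun k ω => maxAbs (B k) X ω / f (b k))
    (fun k => div_pos (ha k) (hfb k))
    (fun k => (hblock k (B k) (hBk k) (Finset.insert_nonempty _ _)).div (hfb k)) (F.sup κ)
  refine hsum.mono hα (aemeasurable_maxAbs fun t ht => (hX t (hFV t ht)).div_const _)
    (fun ω => ?_) (Finset.sum_nonneg fun k _ => (div_pos (ha k) (hfb k)).le)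
    (sum_le_hasSum _ (fun k _ => (div_pos (ha k) (hfb k)).le) hC)
    (sum_le_hasSum _ (fun k _ => div_nonneg (hm k) (hfb k).le) hM)
  obtain ⟨t, ht, h⟩ := exists_maxAbs_eq hF (fun t ω => X t ω / f t.1) ω
  have htB := hκ t (hFV t ht)
  have hft : f (b (κ t)) ≤ f t.1 := hfmono (hbk _) (hFV t ht).1 htB.1.1
  rw [h, abs_div, abs_of_pos (hfpos _ (hFV t ht).1)]
  calc |X t ω| / f t.1 ≤ maxAbs (B (κ t)) X ω / f (b (κ t)) := by
        have := hfb (κ t)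
        exact div_le_div₀ (maxAbs_nonneg _ _ _)
          (abs_le_maxAbs X ω (Finset.mem_insert_of_mem (Finset.mem_filter.2 ⟨ht, htB⟩))) this hft
    _ ≤ _ := Finset.single_le_sum
        (f := fun k => maxAbs (B k) X ω / f (b k))
        (fun k _ => div_nonneg (maxAbs_nonneg _ _ _) (hfb k).le)
        (Finset.mem_range.2 (Nat.lt_succ_of_le (Finset.le_sup ht)))

/-- For a separable field the weighted supremum may be taken over a countable set. -/
theorem IsSeparableField.exists_countable_iSup_eq {X : ℝ × ℝ → Ω → ℝ} {A : ℝ} {f : ℝ → ℝ}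
    (hX : IsSeparableField P (domainV A) X) (hA : 0 ≤ A) (hfpos : ∀ t, 0 ≤ t → 0 < f t)
    (hfcont : ContinuousOn f (Ici 0)) :
    ∃ D : Set (ℝ × ℝ), D ⊆ domainV A ∧ D.Countable ∧ D.Nonempty ∧
      ∀ᵐ ω ∂P, supRatio X f A ω = ⨆ t : D, ((|X t.1 ω| / f t.1.1 : ℝ) : EReal) := by
  obtain ⟨D, hDV, hDc, hVD, N, hN, hsep⟩ := hX
  have hDn : D.Nonempty := by
    have h0 : ((0, 0) : ℝ × ℝ) ∈ domainV A := ⟨by simp, by simpa using hA, hA⟩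
    exact closure_nonempty_iff.1 ⟨_, hVD h0⟩
  refine ⟨D, hDV, hDc, hDn, measure_mono_null (fun ω hω => ?_) hN⟩
  by_contra hωN
  refine hω (le_antisymm (iSup_le fun t => ?_) (iSup_le fun t =>
    le_iSup (fun t : domainV A => ((|X t.1 ω| / f t.1.1 : ℝ) : EReal)) ⟨t.1, hDV t.2⟩))
  obtain ⟨t, ht⟩ := t
  have hle : ∀ s : D, ((|X s.1 ω| / f s.1.1 : ℝ) : EReal) ≤
      ⨆ t : D, ((|X t.1 ω| / f t.1.1 : ℝ) : EReal) :=
    le_iSup fun t : D => ((|X t.1 ω| / f t.1.1 : ℝ) : EReal)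
  generalize (⨆ t : D, ((|X t.1 ω| / f t.1.1 : ℝ) : EReal)) = M at hle
  induction M with
  | bot => exact absurd (hle ⟨_, hDn.some_mem⟩) (by simp)
  | top => exact le_top
  | coe r =>
    have hD : ∀ s ∈ D, |X s ω| ≤ r * f s.1 := fun s hs =>
      (div_le_iff₀ (hfpos _ (hDV hs).1)).1 (EReal.coe_le_coe_iff.1 (hle ⟨s, hs⟩))
    rw [EReal.coe_le_coe_iff, div_le_iff₀ (hfpos _ ht.1)]
    refine le_of_forall_pos_le_add fun δ hδ => ?_
    -- Near `t` the weight varies by less than `δ`, so on `G ∩ D` the field stays in a fixed closed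
    -- interval, to which separability applies. The exceptional set `N` does not depend on `G`, `r`
    -- or `δ`.
    have hc : ContinuousWithinAt (fun s : ℝ × ℝ => r * f s.1) (domainV A) t :=
      continuousWithinAt_const.mul ((hfcont t.1 ht.1).comp continuous_fst.continuousWithinAt
        fun s hs => hs.1)
    obtain ⟨G, hG, htG, hGV⟩ := mem_nhdsWithin.1
      (hc.eventually (gt_mem_nhds (lt_add_of_pos_right (r * f t.1) hδ)))
    by_contra hcon
    refine hωN (hsep G (Icc (-(r * f t.1 + δ)) (r * f t.1 + δ)) hG isClosed_Icc
      ⟨fun s hs => ?_, fun h => hcon (abs_le.2 (h t ⟨htG, ht⟩))⟩)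
    exact abs_le.1 ((hD s hs.2).trans (hGV ⟨hs.1, hDV hs.2⟩).le)

/-- Uniform bounds for finite maxima pass to the supremum over a countable set. -/
theorem lintegral_exp_iSup_le {E : Type*} {D : Set E} (hD : D.Countable) {Y : E → Ω → ℝ}
    (hY : ∀ t ∈ D, AEMeasurable (Y t) P) {lam : ℝ} (hlam : 0 < lam) {K : ℝ≥0∞}
    (hK : ∀ F : Finset E, F.Nonempty → (∀ t ∈ F, t ∈ D) →
      ∫⁻ ω, ENNReal.ofReal (Real.exp (lam * maxAbs F Y ω)) ∂P ≤ K) :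
    ∫⁻ ω, EReal.exp ((lam : EReal) * ⨆ t : D, ((|Y t.1 ω| : ℝ) : EReal)) ∂P ≤ K := by
  classical
  have := hD.to_subtype
  have hm : ∀ t : D, AEMeasurable (fun ω => ENNReal.ofReal (Real.exp (lam * |Y t.1 ω|))) P :=
    fun t => (Real.measurable_exp.comp_aemeasurable
      (((hY t.1 t.2).abs).const_mul lam)).ennreal_ofReal
  have hbound : ∀ F : Finset D,
      ∫⁻ ω, F.sup (fun t => ENNReal.ofReal (Real.exp (lam * |Y t.1 ω|))) ∂P ≤ K := fun F => by
    rcases F.eq_empty_or_nonempty with rfl | hF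
    · simp
    · refine le_trans (lintegral_mono fun ω => Finset.sup_le fun t ht => ?_)
        (hK (F.image Subtype.val) (hF.image _) fun t ht => ?_)
      · gcongr
        exact abs_le_maxAbs Y ω (Finset.mem_image_of_mem _ ht)
      · obtain ⟨s, -, rfl⟩ := Finset.mem_image.1 ht
        exact s.2
  have hdir : Directed (· ≤ ·) fun (F : Finset D) (ω : Ω) =>
      F.sup fun t => ENNReal.ofReal (Real.exp (lam * |Y t.1 ω|)) :=
    Monotone.directed_le fun F F' h ω => Finset.sup_mono h
  have hsupm : ∀ F : Finset D, AEMeasurable (fun ω =>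
      F.sup fun t => ENNReal.ofReal (Real.exp (lam * |Y t.1 ω|))) P := fun F => by
    have : AEMeasurable (F.sup fun (t : D) ω => ENNReal.ofReal (Real.exp (lam * |Y t.1 ω|))) P :=
      Finset.sup_induction (p := fun g : Ω → ℝ≥0∞ => AEMeasurable g P) aemeasurable_const
        (fun _ h₁ _ h₂ => h₁.sup h₂) fun t _ => hm t
    refine this.congr (Eventually.of_forall fun ω => ?_)
    simp [Finset.sup_apply]
  calc _ ≤ ∫⁻ ω, ⨆ F : Finset D,
          F.sup (fun t => ENNReal.ofReal (Real.exp (lam * |Y t.1 ω|))) ∂P := by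
        refine lintegral_mono fun ω => ?_
        generalize hM : (⨆ F : Finset D,
          F.sup (fun t => ENNReal.ofReal (Real.exp (lam * |Y t.1 ω|)))) = M
        -- Every value in [0, ∞] is an exponential of an extended real, so the comparison can be
        -- made between exponents, where the supremum is taken.
        obtain ⟨z, rfl⟩ := EReal.expOrderIso.surjective M
        change _ ≤ EReal.exp z
        refine EReal.exp_monotone ?_
        have hl0 : (0 : EReal) < lam := EReal.coe_pos.2 hlam
        rw [mul_comm, ← EReal.le_div_iff_mul_le hl0 (EReal.coe_ne_top _)]
        refine iSup_le fun t => ?_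
        rw [EReal.le_div_iff_mul_le hl0 (EReal.coe_ne_top _), ← EReal.coe_mul, mul_comm]
        refine EReal.expOrderIso.le_iff_le.1 ?_
        rw [← hM]
        refine le_trans ?_ (le_iSup _ {t})
        rw [Finset.sup_singleton]
        exact (EReal.exp_coe _).ge
    _ = ⨆ F : Finset D, ∫⁻ ω,
          F.sup (fun t => ENNReal.ofReal (Real.exp (lam * |Y t.1 ω|))) ∂P :=
        lintegral_iSup_directed hsupm hdir
    _ ≤ K := iSup_le hbound

/-- The Chernoff bound with the optimal exponent. -/
theorem measure_lt_le_of_lintegral_exp_le {α β a m u : ℝ} (hαβ : α.HolderConjugate β) (ha : 0 < a)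
    (hu : m < u) {Z : Ω → EReal} (hZ : AEMeasurable Z P)
    (h : ∀ lam : ℝ, 0 < lam → ∫⁻ ω, EReal.exp ((lam : EReal) * Z ω) ∂P ≤
      ENNReal.ofReal (Real.exp (Real.log 2 + (lam * a) ^ α / α + lam * m))) :
    P {ω | (u : EReal) < Z ω} ≤ ENNReal.ofReal (2 * Real.exp (-(((u - m) / a) ^ β / β))) := by
  have hα := hαβ.pos
  have hβ := hαβ.symm.pos
  set y := (u - m) / a with hy
  have hy0 : 0 < y := div_pos (by linarith) ha
  -- The maximizer of `lam * (u - m) - (lam * a) ^ α / α`; the maximum is `y ^ β / β`.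
  set lam := y ^ (β - 1) / a with hlam
  have hl : 0 < lam := by positivity
  have hmono : Monotone fun z : EReal => (lam : EReal) * z := fun z w hzw =>
    mul_le_mul_of_nonneg_left hzw (EReal.coe_nonneg.2 hl.le)
  have hmeas : AEMeasurable (fun ω => EReal.exp ((lam : EReal) * Z ω)) P :=
    EReal.measurable_exp.comp_aemeasurable (hmono.measurable.comp_aemeasurable hZ)
  have hmarkov := (mul_meas_ge_le_lintegral₀ hmeas (ENNReal.ofReal (Real.exp (lam * u)))).trans
    (h lam hl)
  have hsub : {ω | (u : EReal) < Z ω} ⊆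
      {ω | ENNReal.ofReal (Real.exp (lam * u)) ≤ EReal.exp ((lam : EReal) * Z ω)} := fun ω hω => by
    have h1 := EReal.exp_monotone (hmono (le_of_lt hω))
    simpa only [mem_ofPred_eq, ← EReal.coe_mul, EReal.exp_coe] using h1
  have hexp : Real.log 2 + (lam * a) ^ α / α + lam * m =
      lam * u + (Real.log 2 + -(y ^ β / β)) := by
    have e1 : (lam * a) ^ α = y ^ β := by
      rw [hlam, div_mul_cancel₀ _ ha.ne', ← Real.rpow_mul hy0.le, mul_comm, mul_sub, mul_one,
        hαβ.mul_eq_add, add_sub_cancel_left]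
    have e2 : lam * (u - m) = y ^ β := by
      rw [show u - m = a * y by rw [hy]; field_simp, ← mul_assoc, hlam, div_mul_cancel₀ _ ha.ne',
        Real.rpow_sub_one hy0.ne', div_mul_cancel₀ _ hy0.ne']
    have e3 : y ^ β / α = y ^ β - y ^ β / β := by
      have := hαβ.inv_add_inv_eq_one
      rw [div_eq_mul_inv, div_eq_mul_inv]
      linear_combination y ^ β * this
    rw [e1, e3, ← e2]
    ring
  rw [hexp, Real.exp_add, ENNReal.ofReal_mul (Real.exp_pos _).le] at hmarkov
  have hne : ENNReal.ofReal (Real.exp (lam * u)) ≠ 0 := by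
    simpa using Real.exp_pos _
  have := (ENNReal.mul_le_mul_iff_right hne ENNReal.ofReal_ne_top).1 hmarkov
  refine (measure_mono hsub).trans (this.trans_eq ?_)
  rw [Real.exp_add, Real.exp_log two_pos]

end Field

end PhiSub

/-! ### Assembly of the theorem. -/

theorem mainTheorem2 {Ω : Type*} [MeasurableSpace Ω] (P : Measure Ω) [IsProbabilityMeasure P]
    (α β γ H₁ H₂ A : ℝ) (hα : 1 < α) (hα2 : α ≤ 2) (hβ : β = α / (α - 1))
    (hγ : 0 < γ) (hγ1 : γ ≤ 1) (hγβ : 1 < γ * β)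
    (hH₁ : 0 < H₁) (hH₁1 : H₁ ≤ 1) (hH₂ : 0 < H₂) (hH₂1 : H₂ ≤ 1) (hA : 0 ≤ A)
    -- the normalizing function and the partition
    (f : ℝ → ℝ) (hfpos : ∀ t, 0 ≤ t → 0 < f t) (hfcont : ContinuousOn f (Set.Ici 0))
    (hfmono : StrictMonoOn f (Set.Ici 0)) (hftop : Tendsto f atTop atTop)
    (b : ℕ → ℝ) (hb0 : b 0 = 0) (hbmono : ∀ k, b k < b (k + 1)) (hbtop : Tendsto b atTop atTop)
    -- the separable sub-Gaussian field
    (X : ℝ × ℝ → Ω → ℝ)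
    (hX : ∀ t ∈ PhiSub.domainV A, PhiSub.IsPhiSubGaussian (PhiSub.phi α) P (X t))
    (hXsep : PhiSub.IsSeparableField P (PhiSub.domainV A) X)
    -- every `ε_k` is finite and positive
    (hεfin : ∀ k, BddAbove ((fun t => PhiSub.tau (PhiSub.phi α) P (X t)) '' PhiSub.block A b k))
    (hεpos : ∀ k, 0 < PhiSub.eps (PhiSub.phi α) P X A b k)
    -- the increments on each block
    (c : ℕ → ℝ) (hc : ∀ k, 0 < c k)
    (hincr : ∀ k, ∀ h : ℝ, 0 < h → ∀ t ∈ PhiSub.block A b k, ∀ s ∈ PhiSub.block A b k,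
      PhiSub.dist2 H₁ H₂ t s ≤ h →
        PhiSub.tau (PhiSub.phi α) P (fun ω => X t ω - X s ω) ≤ c k * h ^ γ)
    -- the two series converge, with sums `C` and `S`
    (C S : ℝ)
    (hC : HasSum (fun k => PhiSub.eps (PhiSub.phi α) P X A b k / f (b k)) C)
    (hS : HasSum (fun k => PhiSub.eps (PhiSub.phi α) P X A b k ^ (1 - 1 / (γ * β)) *
      PhiSub.cOne β γ H₁ H₂ A b c k / f (b k)) S) :
    AEMeasurable (PhiSub.supRatio X f A) P ∧
    ∀ θ : ℝ, 0 < θ →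
      θ < min 1 (⨅ k, PhiSub.gam γ H₁ H₂ A b c k / PhiSub.eps (PhiSub.phi α) P X A b k) →
      (∀ lam : ℝ, 0 < lam →
        ∫⁻ ω, EReal.exp ((lam : EReal) * PhiSub.supRatio X f A ω) ∂P ≤
          ENNReal.ofReal (2 * Real.exp (lam ^ α / α * (C / (1 - θ)) ^ α +
            2 * lam / ((1 - θ) * θ ^ (1 / (γ * β))) * S))) ∧
      (∀ u : ℝ, 2 * S / ((1 - θ) * θ ^ (1 / (γ * β))) < u →
        P {ω | (u : EReal) < PhiSub.supRatio X f A ω} ≤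
          ENNReal.ofReal (2 * Real.exp (-(1 / (β * C ^ β)) *
            (u * (1 - θ) - 2 * S * θ ^ (-(1 / (γ * β)))) ^ β))) := by
  have hα0 : 0 < α := by linarith
  have hαβ : α.HolderConjugate β := by
    rw [Real.holderConjugate_iff]
    refine ⟨hα, ?_⟩
    rw [hβ]
    have : α - 1 ≠ 0 := by linarith
    field_simp
    ring
  have hβ0 : 0 < β := hαβ.symm.pos
  have hb : Monotone b := monotone_nat_of_le_succ fun k => (hbmono k).le
  have hbk : ∀ k, 0 ≤ b k := fun k => hb0 ▸ hb k.zero_le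
  have hfb : ∀ k, 0 < f (b k) := fun k => hfpos _ (hbk k)
  have hblockV : ∀ k, PhiSub.block A b k ⊆ PhiSub.domainV A := fun k t ht =>
    ⟨(hbk k).trans ht.1.1, ht.2⟩
  obtain ⟨D, hDV, hDc, hDn, hsup⟩ :=
    hXsep.exists_countable_iSup_eq hA hfpos hfcont
  have hXm : ∀ t ∈ PhiSub.domainV A, AEMeasurable (fun ω => X t ω / f t.1) P := fun t ht =>
    (hX t ht).aemeasurable.div_const _
  have hmeas : AEMeasurable (PhiSub.supRatio X f A) P := by
    have := hDc.to_subtype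
    have h : AEMeasurable (fun ω => ⨆ t : D, ((|X t.1 ω| / f t.1.1 : ℝ) : EReal)) P :=
      AEMeasurable.iSup fun t =>
        ((hX t.1 (hDV t.2)).aemeasurable.abs.div_const _).coe_real_ereal
    exact h.congr (hsup.mono fun ω hω => hω.symm)
  refine ⟨hmeas, fun θ hθ hθlt => ?_⟩
  have hθ1 : θ < 1 := hθlt.trans_le (min_le_left _ _)
  have hθ' : 0 < 1 - θ := by linarith
  have hκ1 : 0 < 1 - 1 / (γ * β) := sub_pos.2 ((div_lt_one (by positivity)).2 hγβ)
  set ε : ℕ → ℝ := PhiSub.eps (PhiSub.phi α) P X A b with hεdef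
  set R : ℝ := 2 / ((1 - θ) * θ ^ (1 / (γ * β))) with hR
  have hR0 : 0 < R := by positivity
  have hone : ∀ k, 0 ≤ PhiSub.cOne β γ H₁ H₂ A b c k := fun k => by
    have h1 : 0 ≤ b (k + 1) - b k := sub_nonneg.2 (hbmono k).le
    have h2 := hc k
    unfold PhiSub.cOne
    positivity
  have hblock : ∀ k (F : Finset (ℝ × ℝ)), (∀ t ∈ F, t ∈ PhiSub.block A b k) → F.Nonempty →
      PhiSub.ExpTailBound α P (PhiSub.maxAbs F X) (ε k / (1 - θ))
        (R * (ε k ^ (1 - 1 / (γ * β)) * PhiSub.cOne β γ H₁ H₂ A b c k)) := fun k F hFk hF => by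
    have e : b k + (b (k + 1) - b k) = b (k + 1) := by ring
    refine PhiSub.expTailBound_maxAbs_rectangle (x := b k) (l := b (k + 1) - b k) hαβ hγ hγβ
      hH₁ hH₁1 hH₂ hH₂1 hA (sub_nonneg.2 (hbmono k).le) hθ hθ1 (hεpos k) (hc k) ?_ ?_ F ?_ hF
    · rw [e]
      exact fun t ht => PhiSub.subExpBound_of_tau_le hα0
        (hX t (hblockV k ht)).exists_subExpBound (le_csSup (hεfin k) ⟨t, ht, rfl⟩)
    · rw [e]
      exact fun h hh t ht s hs hts => PhiSub.subExpBound_of_tau_le hα0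
        ((hX t (hblockV k ht)).exists_subExpBound_sub (hX s (hblockV k hs)))
        (hincr k h hh t ht s hs hts)
    · rw [e]
      exact hFk
  have hC' : HasSum (fun k => ε k / (1 - θ) / f (b k)) (C / (1 - θ)) := by
    have e : ∀ k, ε k / (1 - θ) / f (b k) = ε k / f (b k) / (1 - θ) := fun k =>
      div_right_comm _ _ _
    simpa only [e] using hC.div_const (1 - θ)
  have hS' : HasSum (fun k => R * (ε k ^ (1 - 1 / (γ * β)) *
      PhiSub.cOne β γ H₁ H₂ A b c k) / f (b k)) (R * S) := by
    simpa only [mul_div_assoc] using hS.mul_left R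
  have hfinite := PhiSub.expTailBound_maxAbs_domain (P := P) (X := X) hα0 hA hfpos
    hfmono.monotoneOn hb0 hbmono hbtop (fun t ht => (hX t ht).aemeasurable)
    (fun k => div_pos (hεpos k) hθ')
    (fun k => mul_nonneg hR0.le (mul_nonneg (Real.rpow_nonneg (hεpos k).le _) (hone k)))
    hblock hC' hS'
  have hCpos : 0 < C := by
    have h0 : 0 < ε 0 / f (b 0) := div_pos (hεpos 0) (hfb 0)
    exact h0.trans_le (le_hasSum hC 0 fun k _ => (div_pos (hεpos k) (hfb k)).le)
  have hexp : ∀ lam : ℝ, 0 < lam →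
      ∫⁻ ω, EReal.exp ((lam : EReal) * PhiSub.supRatio X f A ω) ∂P ≤
        ENNReal.ofReal (Real.exp (Real.log 2 + (lam * (C / (1 - θ))) ^ α / α + lam * (R * S))) :=
    fun lam hlam => by
    have h := PhiSub.lintegral_exp_iSup_le (P := P) hDc (Y := fun t ω => X t ω / f t.1)
      (fun t ht => hXm t (hDV ht)) hlam
      fun F hF hFD => (hfinite F hF fun t ht => hDV (hFD t ht)).2 lam hlam
    refine le_trans (lintegral_congr_ae ?_).le h
    filter_upwards [hsup] with ω hω
    rw [hω]
    refine congrArg (fun z => EReal.exp ((lam : EReal) * z)) (iSup_congr fun t => ?_)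
    rw [abs_div, abs_of_pos (hfpos _ (hDV t.2).1)]
  refine ⟨fun lam hlam => (hexp lam hlam).trans_eq ?_, fun u hu => ?_⟩
  · rw [add_assoc, Real.exp_add, Real.exp_log two_pos,
      Real.mul_rpow hlam.le (div_pos hCpos hθ').le]
    congr 3
    rw [hR]
    ring
  · have hu' : R * S < u := by
      refine lt_of_eq_of_lt ?_ hu
      rw [hR]
      ring
    refine (PhiSub.measure_lt_le_of_lintegral_exp_le hαβ (div_pos hCpos hθ') hu' hmeas
      hexp).trans_eq ?_
    have hθκ : 0 < θ ^ (1 / (γ * β)) := by positivity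
    have e : (u - R * S) / (C / (1 - θ)) =
        (u * (1 - θ) - 2 * S * θ ^ (-(1 / (γ * β)))) / C := by
      rw [Real.rpow_neg hθ.le, hR]
      field_simp
    -- The power of the quotient splits only for a nonnegative numerator, which is the assumed lower
    -- bound on `u`.
    have hnum : 0 ≤ u * (1 - θ) - 2 * S * θ ^ (-(1 / (γ * β))) := by
      have h1 : 0 < (u - R * S) / (C / (1 - θ)) :=
        div_pos (sub_pos.2 hu') (div_pos hCpos hθ')
      rw [e] at h1
      exact ((div_pos_iff_of_pos_right hCpos).1 h1).le
    rw [e, Real.div_rpow hnum hCpos.le]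
    congr 3
    field_simp
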